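/- Let $n\ge 2$ and let $A=[a_{ij}]\in\mathbb{C}^{n\times n}$. For $1\le i\le n$ write $r_i=r_i(A)=\sum_{j\ne i}|a_{ij}|$ and $c_i=c_i(A)=\sum_{j\ne i}|a_{ji}|$ for the deleted absolute row and column sums. The matrix $A$ is strictly diagonally dominant if $|a_{ii}|>r_i(A)$ for all $i$, and generalized diagonally dominant, written $A\in GDD$, if $X^{-1}AX$ is strictly diagonally dominant for some diagonal matrix $X$ with positive diagonal entries. Powers with exponent $0$ are equal to $1$ (in particular $0^0=1$). Suppose there exist $\alpha,\beta\in[0,1]$ such that at least one of the following thirty-one conditions is satisfied for all $i,j\in\{1,\dots,n\}$ with $i\ne j$ (the same condition for all pairs): (1) $|a_{ii}| > r_i$; (2) $|a_{ii}| > c_i$; (3) $|a_{ii}| > r_i^{\alpha}\,c_i^{1-\alpha}$; (4) $|a_{ii}| > \alpha\,r_i+(1-\alpha)\,c_i$; (5) $|a_{ii}||a_{jj}| > r_i\,r_j$; (6) $|a_{ii}||a_{jj}| > c_i\,c_j$; (7) $|a_{ii}||a_{jj}| > r_i\,c_j$; (8) $|a_{ii}||a_{jj}| > (r_i\,r_j)^{\alpha}\,(c_i\,c_j)^{1-\alpha}$;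 (9) $|a_{ii}||a_{jj}| > (r_i\,c_j)^{\alpha}\,(r_j\,c_i)^{1-\alpha}$; (10) $|a_{ii}||a_{jj}| > \alpha\,r_i\,r_j+(1-\alpha)\,c_i\,c_j$; (11) $|a_{ii}||a_{jj}| > \alpha\,r_i\,c_j+(1-\alpha)\,r_j\,c_i$; (12) $|a_{ii}||a_{jj}| > (\alpha\,r_i+(1-\alpha)\,c_i)\,(\alpha\,r_j+(1-\alpha)\,c_j)$; (13) $|a_{ii}||a_{jj}| > (\alpha\,r_i+(1-\alpha)\,c_i)\,(\alpha\,c_j+(1-\alpha)\,r_j)$; (14) $|a_{ii}||a_{jj}| > (\alpha\,r_i+(1-\alpha)\,c_j)\,(\alpha\,r_j+(1-\alpha)\,c_i)$; (15) $|a_{ii}||a_{jj}| > (\alpha\,r_i+(1-\alpha)\,r_j)\,(\alpha\,c_j+(1-\alpha)\,c_i)$; (16) $|a_{ii}|^{\alpha}|a_{jj}|^{1-\alpha} > r_i^{\alpha}\,r_j^{1-\alpha}$; (17) $|a_{ii}|^{\alpha}|a_{jj}|^{1-\alpha} > c_i^{\alpha}\,c_j^{1-\alpha}$; (18) $|a_{ii}|^{\alpha}|a_{jj}|^{1-\alpha}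 > r_i^{\alpha}\,c_j^{1-\alpha}$; (19) $|a_{ii}|^{\alpha}|a_{jj}|^{1-\alpha} > \alpha\,r_i+(1-\alpha)\,r_j$; (20) $|a_{ii}|^{\alpha}|a_{jj}|^{1-\alpha} > \alpha\,c_i+(1-\alpha)\,c_j$; (21) $|a_{ii}|^{\alpha}|a_{jj}|^{1-\alpha} > \alpha\,r_i+(1-\alpha)\,c_j$; (22) $|a_{ii}|^{\alpha}|a_{jj}|^{1-\alpha} > (r_i^{\beta}\,c_i^{1-\beta})^{\alpha}\,(r_j^{\beta}\,c_j^{1-\beta})^{1-\alpha}$; (23) $|a_{ii}|^{\alpha}|a_{jj}|^{1-\alpha} > (r_i^{\beta}\,c_i^{1-\beta})^{\alpha}\,(c_j^{\beta}\,r_j^{1-\beta})^{1-\alpha}$; (24) $|a_{ii}|^{\alpha}|a_{jj}|^{1-\alpha} > \beta\,r_i^{\alpha}\,r_j^{1-\alpha}+(1-\beta)\,c_i^{\alpha}\,c_j^{1-\alpha}$; (25) $|a_{ii}|^{\alpha}|a_{jj}|^{1-\alpha} > \beta\,r_i^{\alpha}\,c_j^{1-\alpha}+(1-\beta)\,c_i^{\alpha}\,r_j^{1-\alpha}$;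 (26) $|a_{ii}|^{\alpha}|a_{jj}|^{1-\alpha} > \alpha\,r_i^{\beta}\,c_i^{1-\beta}+(1-\alpha)\,r_j^{\beta}\,c_j^{1-\beta}$; (27) $|a_{ii}|^{\alpha}|a_{jj}|^{1-\alpha} > \alpha\,r_i^{\beta}\,c_i^{1-\beta}+(1-\alpha)\,c_j^{\beta}\,r_j^{1-\beta}$; (28) $|a_{ii}|^{\alpha}|a_{jj}|^{1-\alpha} > (\beta\,r_i+(1-\beta)\,c_i)^{\alpha}\,(\beta\,r_j+(1-\beta)\,c_j)^{1-\alpha}$; (29) $|a_{ii}|^{\alpha}|a_{jj}|^{1-\alpha} > (\beta\,r_i+(1-\beta)\,c_i)^{\alpha}\,(\beta\,c_j+(1-\beta)\,r_j)^{1-\alpha}$; (30) $|a_{ii}|^{\alpha}|a_{jj}|^{1-\alpha} > (\alpha\,r_i+(1-\alpha)\,c_j)^{\beta}\,(\alpha\,c_i+(1-\alpha)\,r_j)^{1-\beta}$; (31) $|a_{ii}|^{\alpha}|a_{jj}|^{1-\alpha} > (\alpha\,r_i+(1-\alpha)\,r_j)^{\beta}\,(\alpha\,c_i+(1-\alpha)\,c_j)^{1-\beta}$.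 Then $A\in GDD$; hence $A$ is nonsingular. -/

import Mathlib

/-- The `i`-th deleted absolute row sum of a complex square matrix. -/
noncomputable def deletedRowSum {n : ℕ} (A : Matrix (Fin n) (Fin n) ℂ) (i : Fin n) : ℝ :=
  ∑ j ∈ Finset.univ.erase i, ‖A i j‖

/-- The `i`-th deleted absolute column sum of a complex square matrix. -/
noncomputable def deletedColSum {n : ℕ} (A : Matrix (Fin n) (Fin n) ℂ) (i : Fin n) : ℝ :=
  ∑ j ∈ Finset.univ.erase i, ‖A j i‖

/-- Strict diagonal dominance by rows. -/
def IsSDD {n : ℕ} (A : Matrix (Fin n) (Fin n) ℂ) : Prop :=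
  ∀ i, ‖A i i‖ > deletedRowSum A i

/-- Generalized diagonal dominance by rows: `X⁻¹ A X` is strictly diagonally dominant for some
diagonal matrix `X` with positive diagonal entries. -/
def IsGDD {n : ℕ} (A : Matrix (Fin n) (Fin n) ℂ) : Prop :=
  ∃ x : Fin n → ℝ, (∀ i, 0 < x i) ∧
    IsSDD ((Matrix.diagonal fun i => (x i : ℂ))⁻¹ * A * Matrix.diagonal fun i => (x i : ℂ))

/-- One of the thirty-one families of inequalities, with parameters `α` and `β`, holds for all
pairs of distinct indices. Here `d` stands for the moduli of the diagonal entries, `r` for the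
deleted row sums and `c` for the deleted column sums of a matrix. Powers are real powers of
nonnegative reals, with `0 ^ 0 = 1`. -/
def SatisfiesSomeCondition {n : ℕ} (α β : ℝ) (d r c : Fin n → ℝ) : Prop :=
  (∀ i j, i ≠ j →
    d i > r i) ∨
  (∀ i j, i ≠ j →
    d i > c i) ∨
  (∀ i j, i ≠ j →
    d i > r i ^ α * c i ^ (1 - α)) ∨
  (∀ i j, i ≠ j →
    d i > α * r i + (1 - α) * c i) ∨
  (∀ i j, i ≠ j →
    d i * d j > r i * r j) ∨
  (∀ i j, i ≠ j →
    d i * d j > c i * c j) ∨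
  (∀ i j, i ≠ j →
    d i * d j > r i * c j) ∨
  (∀ i j, i ≠ j →
    d i * d j > (r i * r j) ^ α * (c i * c j) ^ (1 - α)) ∨
  (∀ i j, i ≠ j →
    d i * d j > (r i * c j) ^ α * (r j * c i) ^ (1 - α)) ∨
  (∀ i j, i ≠ j →
    d i * d j > α * (r i * r j) + (1 - α) * (c i * c j)) ∨
  (∀ i j, i ≠ j →
    d i * d j > α * (r i * c j) + (1 - α) * (r j * c i)) ∨
  (∀ i j, i ≠ j →
    d i * d j > (α * r i + (1 - α) * c i) * (α * r j + (1 - α) * c j)) ∨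
  (∀ i j, i ≠ j →
    d i * d j > (α * r i + (1 - α) * c i) * (α * c j + (1 - α) * r j)) ∨
  (∀ i j, i ≠ j →
    d i * d j > (α * r i + (1 - α) * c j) * (α * r j + (1 - α) * c i)) ∨
  (∀ i j, i ≠ j →
    d i * d j > (α * r i + (1 - α) * r j) * (α * c j + (1 - α) * c i)) ∨
  (∀ i j, i ≠ j →
    d i ^ α * d j ^ (1 - α) > r i ^ α * r j ^ (1 - α)) ∨
  (∀ i j, i ≠ j →
    d i ^ α * d j ^ (1 - α) > c i ^ α * c j ^ (1 - α)) ∨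
  (∀ i j, i ≠ j →
    d i ^ α * d j ^ (1 - α) > r i ^ α * c j ^ (1 - α)) ∨
  (∀ i j, i ≠ j →
    d i ^ α * d j ^ (1 - α) > α * r i + (1 - α) * r j) ∨
  (∀ i j, i ≠ j →
    d i ^ α * d j ^ (1 - α) > α * c i + (1 - α) * c j) ∨
  (∀ i j, i ≠ j →
    d i ^ α * d j ^ (1 - α) > α * r i + (1 - α) * c j) ∨
  (∀ i j, i ≠ j →
    d i ^ α * d j ^ (1 - α) > (r i ^ β * c i ^ (1 - β)) ^ α * (r j ^ β * c j ^ (1 - β)) ^ (1 - α)) ∨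
  (∀ i j, i ≠ j →
    d i ^ α * d j ^ (1 - α) > (r i ^ β * c i ^ (1 - β)) ^ α * (c j ^ β * r j ^ (1 - β)) ^ (1 - α)) ∨
  (∀ i j, i ≠ j →
    d i ^ α * d j ^ (1 - α) > β * (r i ^ α * r j ^ (1 - α)) + (1 - β) * (c i ^ α * c j ^ (1 - α))) ∨
  (∀ i j, i ≠ j →
    d i ^ α * d j ^ (1 - α) > β * (r i ^ α * c j ^ (1 - α)) + (1 - β) * (c i ^ α * r j ^ (1 - α))) ∨
  (∀ i j, i ≠ j →
    d i ^ α * d j ^ (1 - α) > α * (r i ^ β * c i ^ (1 - β)) + (1 - α) * (r j ^ β * c j ^ (1 - β))) ∨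
  (∀ i j, i ≠ j →
    d i ^ α * d j ^ (1 - α) > α * (r i ^ β * c i ^ (1 - β)) + (1 - α) * (c j ^ β * r j ^ (1 - β))) ∨
  (∀ i j, i ≠ j →
    d i ^ α * d j ^ (1 - α) > (β * r i + (1 - β) * c i) ^ α * (β * r j + (1 - β) * c j) ^ (1 - α)) ∨
  (∀ i j, i ≠ j →
    d i ^ α * d j ^ (1 - α) > (β * r i + (1 - β) * c i) ^ α * (β * c j + (1 - β) * r j) ^ (1 - α)) ∨
  (∀ i j, i ≠ j →
    d i ^ α * d j ^ (1 - α) > (α * r i + (1 - α) * c j) ^ β * (α * c i + (1 - α) * r j) ^ (1 - β)) ∨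
  (∀ i j, i ≠ j →
    d i ^ α * d j ^ (1 - α) > (α * r i + (1 - α) * r j) ^ β * (α * c i + (1 - α) * c j) ^ (1 - β))

/-! Write `d`, `r`, `c` for the diagonal moduli and deleted sums, and P_i = r_i^γ c_i^(1-γ). AM-GM
replaces arithmetic means by geometric ones. Where needed, multiplying the inequalities for (i, j)
and (j, i) then merges the exponents, so every condition yields P_i P_j < d_i d_j for some γ. Under
this condition P_k ≥ d_k holds for at most one index k, and a diagonal scaling at k restores
Ostrowski's condition P_i < d_i for all i. Let B be the matrix of off-diagonal moduli. GDD asks for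
x > 0 with B x < D x, where D = diag(d). If none exists, some nonzero y ≥ 0 satisfies B y ≥ D y.
Under Ostrowski's condition, Hölder's inequality turns this into c_i y_i^p < ∑_j B_ij y_j^p wherever
y_i > 0 (p = 1/(1-γ), γ < 1). Summing over i gives the same double sum on both sides, a
contradiction. -/

/-! ### An alternative for nonnegative matrices. -/

open Finset Filter Topology in
/-- For a nonnegative matrix `B`, either `B x < x` for some positive vector `x`, or `B y ≥ y` for
some nonzero nonnegative vector `y`. -/
theorem exists_pos_sum_mul_lt_or_exists_le_sum_mul {ι : Type*} [Fintype ι]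
    (B : ι → ι → ℝ) (hB : ∀ i j, 0 ≤ B i j) :
    (∃ x : ι → ℝ, (∀ i, 0 < x i) ∧ ∀ i, ∑ j, B i j * x j < x i) ∨
      ∃ y ∈ stdSimplex ℝ ι, ∀ i, y i ≤ ∑ j, B i j * y j := by
  classical
  rcases isEmpty_or_nonempty ι with hι | hι
  · exact Or.inl ⟨fun _ => 1, fun i => isEmptyElim i, fun i => isEmptyElim i⟩
  by_contra! hcon
  obtain ⟨hx, hy⟩ := hcon
  -- Failure of the second alternative means g > 0 on the simplex; compactness makes this bound
  -- uniform.
  let g : (ι → ℝ) → ℝ := fun y => univ.sup' univ_nonempty fun i => y i - ∑ j, B i j * y j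
  have hg : Continuous g := by
    refine Continuous.finset_sup'_apply _ fun i _ => ?_
    fun_prop
  obtain ⟨y₀, hy₀, hmin⟩ := (isCompact_stdSimplex ℝ ι).exists_isMinOn
    ⟨_, single_mem_stdSimplex ℝ (Classical.arbitrary ι)⟩ hg.continuousOn
  have hδ : 0 < g y₀ := by
    obtain ⟨i, hi⟩ := hy y₀ hy₀
    exact (sub_pos.2 hi).trans_le (le_sup' (fun i => y₀ i - ∑ j, B i j * y₀ j) (mem_univ i))
  -- The iterates of `T` from 0 are the partial sums of the Neumann series ∑ B^m 1. Their limit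
  -- solves x = 1 + B x, so x is positive and B x < x.
  let T : (ι → ℝ) → ι → ℝ := fun x i => 1 + ∑ j, B i j * x j
  have hT : Monotone T := fun x y hxy i => by
    simp only [T]
    gcongr with j
    · exact hB i j
    · exact hxy j
  let u : ℕ → ι → ℝ := fun m => T^[m] 0
  have hsucc : ∀ m, u (m + 1) = T (u m) := fun m => Function.iterate_succ_apply' T m 0
  have hu : Monotone u := by
    refine hT.monotone_iterate_of_le_map fun i => ?_
    simp [T]
  have hu0 : ∀ m i, 0 ≤ u m i := fun m i => hu (Nat.zero_le m) i
  have hsum : ∀ m, ∑ i, u m i ≤ (g y₀)⁻¹ := by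
    intro m
    rcases (sum_nonneg fun i _ => hu0 m i : 0 ≤ ∑ i, u m i).eq_or_lt with h0 | hs
    · rw [← h0]; positivity
    set s := ∑ i, u m i with hs_def
    have hmem : (fun i => u m i / s) ∈ stdSimplex ℝ ι :=
      ⟨fun i => div_nonneg (hu0 m i) hs.le, by rw [← sum_div, div_self hs.ne']⟩
    have hle : g y₀ ≤ g fun i => u m i / s := hmin hmem
    -- Monotonicity gives u_m - B u_m ≤ 1; dividing by s bounds s by the inverse of the minimum of
    -- g.
    have hle' : g (fun i => u m i / s) ≤ s⁻¹ := by
      refine sup'_le _ _ fun i _ => ?_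
      have h1 : u m i ≤ 1 + ∑ j, B i j * u m j := by
        have := hu (Nat.le_succ m) i
        rwa [Nat.succ_eq_add_one, hsucc] at this
      have h2 : ∑ j, B i j * (u m j / s) = (∑ j, B i j * u m j) / s := by
        rw [sum_div]
        exact sum_congr rfl fun j _ => by ring
      rw [h2, ← sub_div, inv_eq_one_div]
      gcongr
      linarith
    exact (le_inv_comm₀ hδ hs).1 (hle.trans hle')
  have hbdd : ∀ i, BddAbove (Set.range fun m => u m i) := fun i =>
    ⟨(g y₀)⁻¹, by
      rintro _ ⟨m, rfl⟩
      exact (single_le_sum (f := u m) (fun i _ => hu0 m i) (mem_univ i)).trans (hsum m)⟩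
  have hlim : ∀ i, Tendsto (fun m => u m i) atTop (𝓝 (⨆ m, u m i)) := fun i =>
    tendsto_atTop_ciSup (fun a b hab => hu hab i) (hbdd i)
  have heq : ∀ i, (⨆ m, u m i) = 1 + ∑ j, B i j * ⨆ m, u m j := by
    intro i
    refine tendsto_nhds_unique ((hlim i).comp (tendsto_add_atTop_nat 1)) ?_
    have : (fun m => u m i) ∘ (fun m => m + 1) = fun m => 1 + ∑ j, B i j * u m j := by
      funext m
      exact congrFun (hsucc m) i
    rw [this]
    exact tendsto_const_nhds.add (tendsto_finsetSum _ fun j _ => (hlim j).const_mul _)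
  have hsup0 : ∀ i, 0 ≤ ⨆ m, u m i := fun i => Real.iSup_nonneg fun m => hu0 m i
  obtain ⟨i, hi⟩ := hx (fun i => ⨆ m, u m i) fun i => by
    rw [heq i]
    have := sum_nonneg fun j (_ : j ∈ univ) => mul_nonneg (hB i j) (hsup0 j)
    linarith
  have := heq i
  linarith

/-! ### Algebra of weighted geometric means. -/

/-- The weighted geometric mean `a ^ γ * b ^ (1 - γ)`. -/
noncomputable def weightedGeomMean (γ a b : ℝ) : ℝ := a ^ γ * b ^ (1 - γ)

section weightedGeomMean

variable {γ a b a' b' : ℝ}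

theorem weightedGeomMean_nonneg (ha : 0 ≤ a) (hb : 0 ≤ b) : 0 ≤ weightedGeomMean γ a b := by
  unfold weightedGeomMean
  positivity

theorem weightedGeomMean_le (hγ : γ ∈ Set.Icc (0 : ℝ) 1) (ha : 0 ≤ a) (hb : 0 ≤ b) :
    weightedGeomMean γ a b ≤ γ * a + (1 - γ) * b :=
  Real.geom_mean_le_arith_mean2_weighted hγ.1 (sub_nonneg.2 hγ.2) ha hb (by ring)

theorem weightedGeomMean_mono (hγ : γ ∈ Set.Icc (0 : ℝ) 1) (ha : 0 ≤ a) (hb : 0 ≤ b)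
    (haa' : a ≤ a') (hbb' : b ≤ b') : weightedGeomMean γ a b ≤ weightedGeomMean γ a' b' :=
  mul_le_mul (Real.rpow_le_rpow ha haa' hγ.1) (Real.rpow_le_rpow hb hbb' (sub_nonneg.2 hγ.2))
    (Real.rpow_nonneg hb _) (Real.rpow_nonneg (ha.trans haa') _)

theorem weightedGeomMean_self (hγ : γ ∈ Set.Icc (0 : ℝ) 1) (ha : 0 ≤ a) :
    weightedGeomMean γ a a = a := by
  rw [weightedGeomMean, ← Real.rpow_add_of_nonneg ha hγ.1 (sub_nonneg.2 hγ.2), add_sub_cancel,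
    Real.rpow_one]

theorem weightedGeomMean_mul_mul (ha : 0 ≤ a) (hb : 0 ≤ b) (ha' : 0 ≤ a') (hb' : 0 ≤ b') :
    weightedGeomMean γ (a * a') (b * b') = weightedGeomMean γ a b * weightedGeomMean γ a' b' := by
  simp only [weightedGeomMean, Real.mul_rpow ha ha', Real.mul_rpow hb hb']
  ring

/-- The two exponents of each factor add up to 1. This eliminates α when the conditions for (i, j)
and (j, i) are multiplied. -/
theorem weightedGeomMean_mul_swap (hγ : γ ∈ Set.Icc (0 : ℝ) 1) (ha : 0 ≤ a) (hb : 0 ≤ b) :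
    weightedGeomMean γ a b * weightedGeomMean γ b a = a * b := by
  rw [← weightedGeomMean_mul_mul ha hb hb ha, mul_comm b a,
    weightedGeomMean_self hγ (mul_nonneg ha hb)]

theorem weightedGeomMean_symm : weightedGeomMean (1 - γ) a b = weightedGeomMean γ b a := by
  rw [weightedGeomMean, weightedGeomMean, sub_sub_cancel, mul_comm]

theorem weightedGeomMean_interchange {α β : ℝ} (ha : 0 ≤ a) (hb : 0 ≤ b) (ha' : 0 ≤ a')
    (hb' : 0 ≤ b') :
    weightedGeomMean β (weightedGeomMean α a b) (weightedGeomMean α a' b') =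
      weightedGeomMean α (weightedGeomMean β a a') (weightedGeomMean β b b') := by
  have h (x y : ℝ) {t : ℝ} (ht : 0 ≤ t) : (t ^ x) ^ y = (t ^ y) ^ x := by
    rw [← Real.rpow_mul ht, ← Real.rpow_mul ht, mul_comm]
  simp only [weightedGeomMean]
  rw [Real.mul_rpow (by positivity) (by positivity), Real.mul_rpow (by positivity) (by positivity),
    Real.mul_rpow (by positivity) (by positivity), Real.mul_rpow (by positivity) (by positivity),
    h α β ha, h (1 - α) β hb, h α (1 - β) ha', h (1 - α) (1 - β) hb']
  ring

theorem weightedGeomMean_weightedGeomMean {α β δ : ℝ} (hα : α ∈ Set.Icc (0 : ℝ) 1)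
    (hβ : β ∈ Set.Icc (0 : ℝ) 1) (hδ : δ ∈ Set.Icc (0 : ℝ) 1) (ha : 0 ≤ a) (hb : 0 ≤ b) :
    weightedGeomMean α (weightedGeomMean β a b) (weightedGeomMean δ a b) =
      weightedGeomMean (α * β + (1 - α) * δ) a b := by
  have h1 := hα.1
  have h2 := sub_nonneg.2 hα.2
  have h3 := hβ.1
  have h4 := sub_nonneg.2 hβ.2
  have h5 := hδ.1
  have h6 := sub_nonneg.2 hδ.2
  have e : 1 - (α * β + (1 - α) * δ) = (1 - β) * α + (1 - δ) * (1 - α) := by ring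
  have e' : α * β + (1 - α) * δ = β * α + δ * (1 - α) := by ring
  simp only [weightedGeomMean]
  rw [e, e', Real.mul_rpow (by positivity) (by positivity),
    Real.mul_rpow (by positivity) (by positivity),
    Real.rpow_add_of_nonneg ha (by positivity) (by positivity),
    Real.rpow_add_of_nonneg hb (by positivity) (by positivity),
    Real.rpow_mul ha, Real.rpow_mul hb, Real.rpow_mul ha, Real.rpow_mul hb]
  ring

end weightedGeomMean

/-! ### Ostrowski's condition. -/

/-- Ostrowski's condition, for a nonnegative matrix `B` and a vector `d` of diagonal entries. -/
theorem exists_pos_sum_mul_lt_of_weightedGeomMean_lt {ι : Type*} [Fintype ι] {α : ℝ}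
    (hα : α ∈ Set.Icc (0 : ℝ) 1) (B : ι → ι → ℝ) (hB : ∀ i j, 0 ≤ B i j) (d : ι → ℝ)
    (h : ∀ i, weightedGeomMean α (∑ j, B i j) (∑ j, B j i) < d i) :
    ∃ x : ι → ℝ, (∀ i, 0 < x i) ∧ ∀ i, ∑ j, B i j * x j < d i * x i := by
  -- For α = 1 the Hölder exponent 1/(1-α) degenerates, but row dominance is then immediate.
  rcases hα.2.eq_or_lt with rfl | hα1
  · refine ⟨fun _ => 1, fun _ => one_pos, fun i => ?_⟩
    simpa [weightedGeomMean] using h i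
  have hr : ∀ i, 0 ≤ ∑ j, B i j := fun i => Finset.sum_nonneg fun j _ => hB i j
  have hc : ∀ i, 0 ≤ ∑ j, B j i := fun i => Finset.sum_nonneg fun j _ => hB j i
  have hd : ∀ i, 0 < d i := fun i => (weightedGeomMean_nonneg (hr i) (hc i)).trans_lt (h i)
  have hdiv : ∀ (x : ι → ℝ) i, ∑ j, B i j / d i * x j = (∑ j, B i j * x j) / d i := fun x i => by
    rw [Finset.sum_div]
    exact Finset.sum_congr rfl fun j _ => by ring
  rcases exists_pos_sum_mul_lt_or_exists_le_sum_mul (fun i j => B i j / d i)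
    (fun i j => div_nonneg (hB i j) (hd i).le) with ⟨x, hx, hlt⟩ | ⟨y, hy, hle⟩
  · refine ⟨x, hx, fun i => ?_⟩
    have := hlt i
    rwa [hdiv, div_lt_iff₀ (hd i), mul_comm (x i)] at this
  exfalso
  have hle' : ∀ i, d i * y i ≤ ∑ j, B i j * y j := fun i => by
    have := hle i
    rwa [hdiv, le_div_iff₀ (hd i), mul_comm (y i)] at this
  have hα' : 0 < 1 - α := sub_pos.2 hα1
  set p : ℝ := (1 - α)⁻¹ with hp
  have hp0 : 0 < p := inv_pos.2 hα'
  have hp1 : 1 ≤ p := (one_le_inv₀ hα').2 (by linarith [hα.1])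
  have hpinv : p⁻¹ = 1 - α := inv_inv _
  have hzc : ∀ i, 0 ≤ (∑ j, B j i) * y i ^ p := fun i =>
    mul_nonneg (hc i) (Real.rpow_nonneg (hy.1 i) _)
  have hS : ∀ i, 0 ≤ ∑ j, B i j * y j ^ p := fun i =>
    Finset.sum_nonneg fun j _ => mul_nonneg (hB i j) (Real.rpow_nonneg (hy.1 j) _)
  have hlt : ∀ i, 0 < y i → (∑ j, B j i) * y i ^ p < ∑ j, B i j * y j ^ p := by
    intro i hi
    by_contra! hge
    have hpow : (∑ j, B i j * y j ^ p) ^ (1 - α) ≤ (∑ j, B j i) ^ (1 - α) * y i := by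
      refine (Real.rpow_le_rpow (hS i) hge hα'.le).trans_eq ?_
      rw [Real.mul_rpow (hc i) (Real.rpow_nonneg hi.le _), ← Real.rpow_mul hi.le, hp,
        inv_mul_cancel₀ hα'.ne', Real.rpow_one]
    -- Hölder with weights B_ij: ∑ B_ij y_j ≤ r_i^α (∑ B_ij y_j^p)^(1-α).
    have hold := Real.inner_le_weight_mul_Lp_of_nonneg Finset.univ hp1 (B i) y (hB i) hy.1
    rw [hpinv, sub_sub_cancel] at hold
    have hstrict := mul_lt_mul_of_pos_right (h i) hi
    have hmul := mul_le_mul_of_nonneg_left hpow (Real.rpow_nonneg (hr i) α)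
    rw [weightedGeomMean, mul_assoc] at hstrict
    linarith [hle' i]
  have hle'' : ∀ i, (∑ j, B j i) * y i ^ p ≤ ∑ j, B i j * y j ^ p := by
    intro i
    rcases (hy.1 i).eq_or_lt with hi | hi
    · rw [← hi, Real.zero_rpow hp0.ne', mul_zero]
      exact hS i
    · exact (hlt i hi).le
  obtain ⟨i, hi⟩ : ∃ i, 0 < y i := by
    by_contra! hcon
    have := hy.2 ▸ Finset.sum_nonpos fun i (_ : i ∈ Finset.univ) => hcon i
    exact absurd this (by norm_num)
  have hsum : ∑ i, (∑ j, B j i) * y i ^ p < ∑ i, ∑ j, B i j * y j ^ p :=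
    Finset.sum_lt_sum (fun i _ => hle'' i) ⟨i, Finset.mem_univ i, hlt i hi⟩
  rw [Finset.sum_comm] at hsum
  simp only [Finset.sum_mul] at hsum
  exact lt_irrefl _ hsum

/-! ### From pairs of indices to single indices. -/

open Filter Topology in
/-- The Brauer–Ostrowski condition on pairs of indices, for a nonnegative matrix `B` with zero
diagonal and a vector `d` of diagonal entries. -/
theorem exists_pos_sum_mul_lt_of_weightedGeomMean_mul_lt {ι : Type*} [Fintype ι] [Nontrivial ι]
    {α : ℝ} (hα : α ∈ Set.Icc (0 : ℝ) 1) (B : ι → ι → ℝ) (hB : ∀ i j, 0 ≤ B i j)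
    (hB0 : ∀ i, B i i = 0) (d : ι → ℝ) (hd : ∀ i, 0 ≤ d i)
    (h : ∀ i j, i ≠ j → weightedGeomMean α (∑ j, B i j) (∑ j, B j i) *
      weightedGeomMean α (∑ l, B j l) (∑ l, B l j) < d i * d j) :
    ∃ x : ι → ℝ, (∀ i, 0 < x i) ∧ ∀ i, ∑ j, B i j * x j < d i * x i := by
  classical
  have hr : ∀ i, 0 ≤ ∑ j, B i j := fun i => Finset.sum_nonneg fun j _ => hB i j
  have hc : ∀ i, 0 ≤ ∑ j, B j i := fun i => Finset.sum_nonneg fun j _ => hB j i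
  by_cases hall : ∀ i, weightedGeomMean α (∑ j, B i j) (∑ j, B j i) < d i
  · exact exists_pos_sum_mul_lt_of_weightedGeomMean_lt hα B hB d hall
  push Not at hall
  obtain ⟨k, hk⟩ := hall
  set P : ι → ℝ := fun i => weightedGeomMean α (∑ j, B i j) (∑ j, B j i) with hP
  have hP0 : ∀ i, 0 ≤ P i := fun i => weightedGeomMean_nonneg (hr i) (hc i)
  have hdk : 0 < d k := by
    obtain ⟨j, hj⟩ := exists_ne k
    have := (mul_nonneg (hP0 k) (hP0 j)).trans_lt (h k j hj.symm)
    exact (pos_and_pos_or_neg_and_neg_of_mul_pos this).elim (fun h => h.1)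
      fun h => absurd h.1 (not_lt.2 (hd k))
  -- The pair condition gives (P_k / d_k) P_i < d_i for i ≠ k, an open condition, so σ may slightly
  -- exceed P_k / d_k.
  obtain ⟨σ, hσk, hσ⟩ : ∃ σ, P k / d k < σ ∧ ∀ i, i ≠ k → σ * P i < d i := by
    have h1 : ∀ᶠ σ in 𝓝[>] (P k / d k), ∀ i, i ≠ k → σ * P i < d i := by
      refine eventually_all.2 fun i => ?_
      by_cases hi : i = k
      · simp [hi]
      have hcont : Tendsto (fun σ : ℝ => σ * P i) (𝓝[>] (P k / d k)) (𝓝 (P k / d k * P i)) :=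
        (tendsto_id.mono_left nhdsWithin_le_nhds).mul_const _
      have hlt : P k / d k * P i < d i := by
        rw [div_mul_eq_mul_div, div_lt_iff₀ hdk, mul_comm (d i)]
        exact h k i (Ne.symm hi)
      filter_upwards [hcont.eventually_lt_const hlt] with σ hσ _ using hσ
    exact (eventually_mem_nhdsWithin.and h1).exists
  have hσ1 : 1 ≤ σ := ((one_le_div hdk).2 hk).trans hσk.le
  have hσ0 : 0 < σ := one_pos.trans_le hσ1
  rw [div_lt_iff₀ hdk] at hσk
  -- Pass to W B W with W = diag(w). Since B_kk = 0, no entry gains a factor σ², so every mean grows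
  -- by at most σ, whereas d_k becomes σ² d_k.
  let w : ι → ℝ := fun i => if i = k then σ else 1
  have hw : ∀ i, 0 < w i := fun i => by
    simp only [w]; split_ifs <;> positivity
  have hwσ : ∀ i, w i ≤ σ := fun i => by
    simp only [w]; split_ifs
    · exact le_rfl
    · exact hσ1
  have hwk : w k = σ := if_pos rfl
  have hwi : ∀ i, i ≠ k → w i = 1 := fun i hi => if_neg hi
  have hB' : ∀ i j, 0 ≤ w i * B i j * w j := fun i j =>
    mul_nonneg (mul_nonneg (hw i).le (hB i j)) (hw j).le
  have key : ∀ i, weightedGeomMean α (∑ j, w i * B i j * w j) (∑ j, w j * B j i * w i) <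
      w i * w i * d i := by
    have hle : ∀ i, weightedGeomMean α (∑ j, w i * B i j * w j) (∑ j, w j * B j i * w i) ≤
        σ * P i := by
      intro i
      rw [← weightedGeomMean_self hα hσ0.le, hP,
        ← weightedGeomMean_mul_mul hσ0.le hσ0.le (hr i) (hc i)]
      have hww : ∀ j, w i * B i j * w j ≤ σ * B i j ∧ w j * B j i * w i ≤ σ * B j i := by
        intro j
        by_cases hi : i = k
        · by_cases hj : j = k
          · simp [hi, hj, hB0]
          · rw [hwi j hj, hi, hwk]
            constructor <;> linarith
        · rw [hwi i hi]
          have h1 := mul_le_mul_of_nonneg_right (hwσ j) (hB i j)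
          have h2 := mul_le_mul_of_nonneg_right (hwσ j) (hB j i)
          constructor <;> linarith
      rw [Finset.mul_sum, Finset.mul_sum]
      exact weightedGeomMean_mono hα (Finset.sum_nonneg fun j _ => hB' i j)
        (Finset.sum_nonneg fun j _ => hB' j i) (Finset.sum_le_sum fun j _ => (hww j).1)
        (Finset.sum_le_sum fun j _ => (hww j).2)
    intro i
    refine (hle i).trans_lt ?_
    by_cases hi : i = k
    · rw [hi, hwk, mul_assoc]
      exact mul_lt_mul_of_pos_left hσk hσ0
    · rw [hwi i hi, one_mul, one_mul]
      exact hσ i hi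
  obtain ⟨x, hx, hlt⟩ := exists_pos_sum_mul_lt_of_weightedGeomMean_lt hα _ hB' _ key
  refine ⟨fun i => w i * x i, fun i => mul_pos (hw i) (hx i), fun i => ?_⟩
  refine lt_of_mul_lt_mul_left ?_ (hw i).le
  calc w i * ∑ j, B i j * (w j * x j) = ∑ j, w i * B i j * w j * x j := by
        rw [Finset.mul_sum]
        exact Finset.sum_congr rfl fun j _ => by ring
    _ < w i * w i * d i * x i := hlt i
    _ = w i * (d i * (w i * x i)) := by ring

/-! ### Reduction of the thirty-one conditions. -/

/-- Each of the thirty-one conditions implies the Brauer–Ostrowski condition for some exponent. -/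
theorem SatisfiesSomeCondition.exists_weightedGeomMean_mul_lt {n : ℕ} {α β : ℝ}
    (hα : α ∈ Set.Icc (0 : ℝ) 1) (hβ : β ∈ Set.Icc (0 : ℝ) 1) {d r c : Fin n → ℝ}
    (hd : ∀ i, 0 ≤ d i) (hr : ∀ i, 0 ≤ r i) (hc : ∀ i, 0 ≤ c i)
    (h : SatisfiesSomeCondition α β d r c) :
    ∃ γ ∈ Set.Icc (0 : ℝ) 1, ∀ i j, i ≠ j →
      weightedGeomMean γ (r i) (c i) * weightedGeomMean γ (r j) (c j) < d i * d j := by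
  have h0 : (0 : ℝ) ∈ Set.Icc (0 : ℝ) 1 := by simp
  have h1 : (1 : ℝ) ∈ Set.Icc (0 : ℝ) 1 := by simp
  have hα' : 1 - α ∈ Set.Icc (0 : ℝ) 1 := ⟨sub_nonneg.2 hα.2, by linarith [hα.1]⟩
  have hβ' : 1 - β ∈ Set.Icc (0 : ℝ) 1 := ⟨sub_nonneg.2 hβ.2, by linarith [hβ.1]⟩
  have nn {γ a b : ℝ} (ha : 0 ≤ a) (hb : 0 ≤ b) := weightedGeomMean_nonneg (γ := γ) ha hb
  have rc {γ : ℝ} (i j) : 0 ≤ weightedGeomMean γ (r i) (c j) := nn (hr i) (hc j)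
  have cr {γ : ℝ} (i j) : 0 ≤ weightedGeomMean γ (c i) (r j) := nn (hc i) (hr j)
  have rr {γ : ℝ} (i j) : 0 ≤ weightedGeomMean γ (r i) (r j) := nn (hr i) (hr j)
  have cc {γ : ℝ} (i j) : 0 ≤ weightedGeomMean γ (c i) (c j) := nn (hc i) (hc j)
  have single {γ : ℝ} (hγ : γ ∈ Set.Icc (0 : ℝ) 1)
      (H : ∀ i j, i ≠ j → weightedGeomMean γ (r i) (c i) < d i) :
      ∃ γ ∈ Set.Icc (0 : ℝ) 1, ∀ i j, i ≠ j →
        weightedGeomMean γ (r i) (c i) * weightedGeomMean γ (r j) (c j) < d i * d j :=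
    ⟨γ, hγ, fun i j hij => mul_lt_mul'' (H i j hij) (H j i hij.symm) (rc i i) (rc j j)⟩
  -- multiplying the inequalities for `(i, j)` and `(j, i)`
  have sq {R : Fin n → Fin n → ℝ} (hR : ∀ i j, 0 ≤ R i j)
      (H : ∀ i j, i ≠ j → R i j < d i * d j)
      (e : ∀ i j, R i j * R j i = r i * c i * (r j * c j)) :
      ∃ γ ∈ Set.Icc (0 : ℝ) 1, ∀ i j, i ≠ j →
        weightedGeomMean γ (r i) (c i) * weightedGeomMean γ (r j) (c j) < d i * d j := by
    -- The multiplied inequalities read r_i c_i r_j c_j < (d_i d_j)²; taking square roots gives γ =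
    -- 1/2, whatever α is.
    refine ⟨1 / 2, by norm_num, fun i j hij => ?_⟩
    have hlt := mul_lt_mul'' (H i j hij) (H j i hij.symm) (hR i j) (hR j i)
    have hhalf (i) : weightedGeomMean (1 / 2) (r i) (c i) * weightedGeomMean (1 / 2) (r i) (c i) =
        r i * c i := by
      have hsym := weightedGeomMean_symm (γ := 1 / 2) (a := r i) (b := c i)
      rw [show (1 : ℝ) - 1 / 2 = 1 / 2 by norm_num] at hsym
      nth_rewrite 2 [hsym]
      exact weightedGeomMean_mul_swap (by norm_num) (hr i) (hc i)
    rw [e, mul_comm (d j)] at hlt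
    refine lt_of_mul_self_lt_mul_self₀ (mul_nonneg (hd i) (hd j)) ?_
    rwa [mul_mul_mul_comm, hhalf, hhalf]
  have pair {γ : ℝ} {R : Fin n → Fin n → ℝ} (hγ : γ ∈ Set.Icc (0 : ℝ) 1) (hR : ∀ i j, 0 ≤ R i j)
      (H : ∀ i j, i ≠ j → R i j < weightedGeomMean α (d i) (d j))
      (e : ∀ i j, R i j * R j i =
        weightedGeomMean γ (r i) (c i) * weightedGeomMean γ (r j) (c j)) :
      ∃ γ ∈ Set.Icc (0 : ℝ) 1, ∀ i j, i ≠ j →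
        weightedGeomMean γ (r i) (c i) * weightedGeomMean γ (r j) (c j) < d i * d j := by
    refine ⟨γ, hγ, fun i j hij => ?_⟩
    have hlt := mul_lt_mul'' (H i j hij) (H j i hij.symm) (hR i j) (hR j i)
    rwa [weightedGeomMean_mul_swap hα (hd i) (hd j), e] at hlt
  have brauer (H : ∀ i j, i ≠ j → weightedGeomMean α (r i * r j) (c i * c j) < d i * d j) :
      ∃ γ ∈ Set.Icc (0 : ℝ) 1, ∀ i j, i ≠ j →
        weightedGeomMean γ (r i) (c i) * weightedGeomMean γ (r j) (c j) < d i * d j :=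
    ⟨α, hα, fun i j hij => by
      rw [← weightedGeomMean_mul_mul (hr i) (hc i) (hr j) (hc j)]
      exact H i j hij⟩
  have cross (H : ∀ i j, i ≠ j → weightedGeomMean α (r i * c j) (r j * c i) < d i * d j) :
      ∃ γ ∈ Set.Icc (0 : ℝ) 1, ∀ i j, i ≠ j →
        weightedGeomMean γ (r i) (c i) * weightedGeomMean γ (r j) (c j) < d i * d j :=
    sq (fun i j => nn (mul_nonneg (hr i) (hc j)) (mul_nonneg (hr j) (hc i))) H fun i j => by
      rw [weightedGeomMean_mul_swap hα (mul_nonneg (hr i) (hc j)) (mul_nonneg (hr j) (hc i))]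
      ring
  have powRow (H : ∀ i j, i ≠ j →
      weightedGeomMean α (r i) (r j) < weightedGeomMean α (d i) (d j)) :
      ∃ γ ∈ Set.Icc (0 : ℝ) 1, ∀ i j, i ≠ j →
        weightedGeomMean γ (r i) (c i) * weightedGeomMean γ (r j) (c j) < d i * d j :=
    pair h1 rr H fun i j => by
      rw [weightedGeomMean_mul_swap hα (hr i) (hr j)]
      simp [weightedGeomMean]
  have powCol (H : ∀ i j, i ≠ j →
      weightedGeomMean α (c i) (c j) < weightedGeomMean α (d i) (d j)) :
      ∃ γ ∈ Set.Icc (0 : ℝ) 1, ∀ i j, i ≠ j →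
        weightedGeomMean γ (r i) (c i) * weightedGeomMean γ (r j) (c j) < d i * d j :=
    pair h0 cc H fun i j => by
      rw [weightedGeomMean_mul_swap hα (hc i) (hc j)]
      simp [weightedGeomMean]
  have powRowCol (H : ∀ i j, i ≠ j →
      weightedGeomMean α (r i) (c j) < weightedGeomMean α (d i) (d j)) :
      ∃ γ ∈ Set.Icc (0 : ℝ) 1, ∀ i j, i ≠ j →
        weightedGeomMean γ (r i) (c i) * weightedGeomMean γ (r j) (c j) < d i * d j :=
    pair hα rc H fun i j => by
      simp only [weightedGeomMean]
      ring
  have powSame (H : ∀ i j, i ≠ j →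
      weightedGeomMean α (weightedGeomMean β (r i) (c i)) (weightedGeomMean β (r j) (c j)) <
        weightedGeomMean α (d i) (d j)) :
      ∃ γ ∈ Set.Icc (0 : ℝ) 1, ∀ i j, i ≠ j →
        weightedGeomMean γ (r i) (c i) * weightedGeomMean γ (r j) (c j) < d i * d j :=
    pair hβ (fun i j => nn (rc i i) (rc j j)) H fun i j =>
      weightedGeomMean_mul_swap hα (rc i i) (rc j j)
  have powSwap (H : ∀ i j, i ≠ j →
      weightedGeomMean α (weightedGeomMean β (r i) (c i)) (weightedGeomMean β (c j) (r j)) <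
        weightedGeomMean α (d i) (d j)) :
      ∃ γ ∈ Set.Icc (0 : ℝ) 1, ∀ i j, i ≠ j →
        weightedGeomMean γ (r i) (c i) * weightedGeomMean γ (r j) (c j) < d i * d j := by
    -- In the product, r_i has exponent β from (i, j) with weight α, and 1-β from (j, i) with weight
    -- 1-α.
    refine pair (γ := α * β + (1 - α) * (1 - β)) ⟨?_, ?_⟩
      (fun i j => nn (rc i i) (cr j j)) H fun i j => ?_
    · exact add_nonneg (mul_nonneg hα.1 hβ.1) (mul_nonneg hα'.1 hβ'.1)
    · nlinarith [mul_nonneg hα.1 hβ'.1, mul_nonneg hα'.1 hβ.1]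
    · rw [← weightedGeomMean_weightedGeomMean hα hβ hβ' (hr i) (hc i),
        ← weightedGeomMean_weightedGeomMean hα hβ hβ' (hr j) (hc j), weightedGeomMean_symm,
        weightedGeomMean_symm]
      simp only [weightedGeomMean]
      ring
  have amgm {γ a b : ℝ} (hγ : γ ∈ Set.Icc (0 : ℝ) 1) (ha : 0 ≤ a) (hb : 0 ≤ b) :=
    weightedGeomMean_le hγ ha hb
  have mono {γ a b a' b' : ℝ} (hγ : γ ∈ Set.Icc (0 : ℝ) 1) (ha : 0 ≤ a) (hb : 0 ≤ b)
    (haa' : a ≤ a') (hbb' : b ≤ b') := weightedGeomMean_mono hγ ha hb haa' hbb'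
  unfold SatisfiesSomeCondition at h
  rcases h with h | h | h | h | h | h | h | h | h | h | h | h | h | h | h | h | h | h | h | h | h |
    h | h | h | h | h | h | h | h | h | h
  · exact single h1 fun i j hij => by simpa [weightedGeomMean] using h i j hij
  · exact single h0 fun i j hij => by simpa [weightedGeomMean] using h i j hij
  · exact single hα h
  · exact single hα fun i j hij => (amgm hα (hr i) (hc i)).trans_lt (h i j hij)
  · exact ⟨1, h1, fun i j hij => by simpa [weightedGeomMean] using h i j hij⟩
  · exact ⟨0, h0, fun i j hij => by simpa [weightedGeomMean] using h i j hij⟩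
  · exact sq (fun i j => mul_nonneg (hr i) (hc j)) h fun i j => by ring
  · exact brauer h
  · exact cross h
  · exact brauer fun i j hij =>
      (amgm hα (mul_nonneg (hr i) (hr j)) (mul_nonneg (hc i) (hc j))).trans_lt (h i j hij)
  · exact cross fun i j hij =>
      (amgm hα (mul_nonneg (hr i) (hc j)) (mul_nonneg (hr j) (hc i))).trans_lt (h i j hij)
  · refine brauer fun i j hij => lt_of_le_of_lt ?_ (h i j hij)
    rw [weightedGeomMean_mul_mul (hr i) (hc i) (hr j) (hc j)]
    exact mul_le_mul (amgm hα (hr i) (hc i)) (amgm hα (hr j) (hc j)) (rc j j)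
      ((rc i i).trans (amgm hα (hr i) (hc i)))
  · refine cross fun i j hij => lt_of_le_of_lt ?_ (h i j hij)
    rw [mul_comm (r j), weightedGeomMean_mul_mul (hr i) (hc i) (hc j) (hr j)]
    exact mul_le_mul (amgm hα (hr i) (hc i)) (amgm hα (hc j) (hr j)) (cr j j)
      ((rc i i).trans (amgm hα (hr i) (hc i)))
  · refine brauer fun i j hij => lt_of_le_of_lt ?_ (h i j hij)
    -- The factors regroup: the means of (r_i, c_j) and (r_j, c_i) multiply to the mean of (r_i r_j,
    -- c_i c_j).
    rw [mul_comm (c i), weightedGeomMean_mul_mul (hr i) (hc j) (hr j) (hc i)]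
    exact mul_le_mul (amgm hα (hr i) (hc j)) (amgm hα (hr j) (hc i)) (rc j i)
      ((rc i j).trans (amgm hα (hr i) (hc j)))
  · refine cross fun i j hij => lt_of_le_of_lt ?_ (h i j hij)
    rw [weightedGeomMean_mul_mul (hr i) (hr j) (hc j) (hc i)]
    exact mul_le_mul (amgm hα (hr i) (hr j)) (amgm hα (hc j) (hc i)) (cc j i)
      ((rr i j).trans (amgm hα (hr i) (hr j)))
  · exact powRow h
  · exact powCol h
  · exact powRowCol h
  · exact powRow fun i j hij => (amgm hα (hr i) (hr j)).trans_lt (h i j hij)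
  · exact powCol fun i j hij => (amgm hα (hc i) (hc j)).trans_lt (h i j hij)
  · exact powRowCol fun i j hij => (amgm hα (hr i) (hc j)).trans_lt (h i j hij)
  · exact powSame h
  · exact powSwap h
  · refine powSame fun i j hij => lt_of_le_of_lt ?_ (h i j hij)
    -- Exchanging the two levels of means puts β outermost, where AM-GM applies.
    rw [weightedGeomMean_interchange (hr i) (hc i) (hr j) (hc j)]
    exact amgm hβ (rr i j) (cc i j)
  · refine powSwap fun i j hij => lt_of_le_of_lt ?_ (h i j hij)
    rw [weightedGeomMean_interchange (hr i) (hc i) (hc j) (hr j)]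
    exact amgm hβ (rc i j) (cr i j)
  · exact powSame fun i j hij => (amgm hα (rc i i) (rc j j)).trans_lt (h i j hij)
  · exact powSwap fun i j hij => (amgm hα (rc i i) (cr j j)).trans_lt (h i j hij)
  · exact powSame fun i j hij => (mono hα (rc i i) (rc j j) (amgm hβ (hr i) (hc i))
      (amgm hβ (hr j) (hc j))).trans_lt (h i j hij)
  · exact powSwap fun i j hij => (mono hα (rc i i) (cr j j) (amgm hβ (hr i) (hc i))
      (amgm hβ (hc j) (hr j))).trans_lt (h i j hij)
  · refine powSwap fun i j hij => lt_of_le_of_lt ?_ (h i j hij)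
    rw [weightedGeomMean_interchange (hr i) (hc i) (hc j) (hr j)]
    exact mono hβ (rc i j) (cr i j) (amgm hα (hr i) (hc j)) (amgm hα (hc i) (hr j))
  · refine powSame fun i j hij => lt_of_le_of_lt ?_ (h i j hij)
    rw [weightedGeomMean_interchange (hr i) (hc i) (hr j) (hc j)]
    exact mono hβ (rr i j) (cc i j) (amgm hα (hr i) (hr j)) (amgm hα (hc i) (hc j))

/-! ### Diagonal similarity and nonsingularity. -/

theorem inv_diagonal_ofReal {n : ℕ} {x : Fin n → ℝ} (hx : ∀ i, 0 < x i) :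
    (Matrix.diagonal fun i => (x i : ℂ))⁻¹ = Matrix.diagonal fun i => (x i : ℂ)⁻¹ := by
  refine Matrix.inv_eq_right_inv ?_
  rw [Matrix.diagonal_mul_diagonal, ← Matrix.diagonal_one]
  congr 1
  funext i
  exact mul_inv_cancel₀ (Complex.ofReal_ne_zero.2 (hx i).ne')

theorem norm_diagonal_conj_apply {n : ℕ} (A : Matrix (Fin n) (Fin n) ℂ) {x : Fin n → ℝ}
    (hx : ∀ i, 0 < x i) (i j : Fin n) :
    ‖((Matrix.diagonal fun i => (x i : ℂ))⁻¹ * A * Matrix.diagonal fun i => (x i : ℂ)) i j‖ =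
      (x i)⁻¹ * (‖A i j‖ * x j) := by
  rw [inv_diagonal_ofReal hx, Matrix.mul_diagonal, Matrix.diagonal_mul, norm_mul, norm_mul,
    norm_inv, Complex.norm_of_nonneg (hx i).le, Complex.norm_of_nonneg (hx j).le, mul_assoc]

/-- Conjugation multiplies the entry (i, j) by x_j / x_i, so each row inequality is divided by x_i.
-/
theorem isGDD_of_sum_mul_lt {n : ℕ} {A : Matrix (Fin n) (Fin n) ℂ} {x : Fin n → ℝ}
    (hx : ∀ i, 0 < x i)
    (h : ∀ i, ∑ j ∈ Finset.univ.erase i, ‖A i j‖ * x j < ‖A i i‖ * x i) : IsGDD A := by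
  refine ⟨x, hx, fun i => ?_⟩
  rw [deletedRowSum, gt_iff_lt]
  simp only [norm_diagonal_conj_apply A hx]
  rw [← Finset.mul_sum]
  exact mul_lt_mul_of_pos_left (h i) (inv_pos.2 (hx i))

theorem IsSDD.det_ne_zero {n : ℕ} {A : Matrix (Fin n) (Fin n) ℂ} (h : IsSDD A) : A.det ≠ 0 :=
  det_ne_zero_of_sum_row_lt_diag h

theorem IsGDD.det_ne_zero {n : ℕ} {A : Matrix (Fin n) (Fin n) ℂ} (h : IsGDD A) : A.det ≠ 0 := by
  obtain ⟨x, -, h⟩ := h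
  intro h0
  refine h.det_ne_zero ?_
  rw [Matrix.det_mul, Matrix.det_mul, h0, mul_zero, zero_mul]

theorem theorem4p7 (n : ℕ) (hn : 2 ≤ n) (A : Matrix (Fin n) (Fin n) ℂ)
    (h : ∃ α ∈ Set.Icc (0 : ℝ) 1, ∃ β ∈ Set.Icc (0 : ℝ) 1,
      SatisfiesSomeCondition α β (fun i => ‖A i i‖) (deletedRowSum A) (deletedColSum A)) :
    IsGDD A ∧ A.det ≠ 0 := by
  obtain ⟨α, hα, β, hβ, h⟩ := h
  obtain ⟨γ, hγ, hlt⟩ := h.exists_weightedGeomMean_mul_lt hα hβ (fun i => norm_nonneg _)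
    (fun i => Finset.sum_nonneg fun j _ => norm_nonneg _)
    (fun i => Finset.sum_nonneg fun j _ => norm_nonneg _)
  have : Nontrivial (Fin n) := Fin.nontrivial_iff_two_le.2 hn
  let B : Fin n → Fin n → ℝ := fun i j => if i = j then 0 else ‖A i j‖
  have hB : ∀ i j, 0 ≤ B i j := fun i j => by
    simp only [B]; split_ifs <;> positivity
  have hB0 : ∀ i, B i i = 0 := fun i => if_pos rfl
  have hBne : ∀ i j, i ≠ j → B i j = ‖A i j‖ := fun i j hij => if_neg hij
  have hmul : ∀ (x : Fin n → ℝ) i,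
      ∑ j, B i j * x j = ∑ j ∈ Finset.univ.erase i, ‖A i j‖ * x j := fun x i => by
    rw [← Finset.sum_erase _ (a := i) (by rw [hB0, zero_mul])]
    exact Finset.sum_congr rfl fun j hj => by rw [hBne i j (Finset.ne_of_mem_erase hj).symm]
  have hrow : ∀ i, ∑ j, B i j = deletedRowSum A i := fun i => by
    simpa [deletedRowSum] using hmul (fun _ => 1) i
  have hcol : ∀ i, ∑ j, B j i = deletedColSum A i := fun i => by
    rw [← Finset.sum_erase (f := fun j => B j i) _ (hB0 i)]
    exact Finset.sum_congr rfl fun j hj => hBne j i (Finset.ne_of_mem_erase hj)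
  obtain ⟨x, hx, hxlt⟩ := exists_pos_sum_mul_lt_of_weightedGeomMean_mul_lt hγ B hB hB0
    (fun i => ‖A i i‖) (fun i => norm_nonneg _) fun i j hij => by
      rw [hrow, hcol, hrow, hcol]
      exact hlt i j hij
  have hgdd : IsGDD A := isGDD_of_sum_mul_lt hx fun i => hmul x i ▸ hxlt i
  exact ⟨hgdd, hgdd.det_ne_zero⟩
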